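/- Let $M$ be a smooth Riemannian manifold of dimension $n\ge 1$ and let $\mathcal M=M\times\mathbb R^{+}$, with local coordinates $(x^1,\dots,x^n,v)$, $v=x^{n+1}>0$. For a nonzero velocity vector $\mathbf v\in T_pM$ put $N^i=v^i/|\mathbf v|$, $N_k=v_k/|\mathbf v|$. Let $\mathbf F$ be the force field of a Newtonian dynamical system on $M$ admitting the normal shift, i.e. a force field $\mathbf F=\mathbf F(p,\mathbf v)$ such that each point of $\mathcal M$ has an open neighbourhood $O$ with a smooth function $W$ on $O$ satisfying $W_v=\partial W/\partial v\ne 0$, and a smooth function $h$ of one variable on $W(O)$, for which $$F_k=\frac{h(W)\,N_k}{W_v}-v\sum_{i=1}^n\frac{\nabla_iW}{W_v}\bigl(2N^iN_k-\delta^i_k\bigr),\qquad \nabla_i W=\frac{\partial W}{\partial x^i},\quad v=|\mathbf v|, \tag{1.4}$$ whenever $(p,|\mathbf v|)\in O$. Let $U\subset T\mathcal M$ be the distribution attached to $\mathbf F$, given locally by $U=\operatorname{Ker}dW$, and let $s$ be the section of $T\mathcal M/U$ attached to $\mathbf F$, given locally by the class of $\frac{h(W)}{W_v}\frac{\partial}{\partial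 v}$ (neither depends on the choice of the pairs $(h,W)$). (a) If $s$ vanishes at no point of $\mathcal M$, then there is a global smooth closed 1-form $\omega$ on $\mathcal M$, with $\omega_{n+1}\neq 0$ everywhere, that determines $\mathbf F$ by $$F_k=\frac{N_k}{\omega_{n+1}}-v\sum_{i=1}^n\frac{\omega_i}{\omega_{n+1}}\bigl(2N^iN_k-\delta^i_k\bigr),\qquad v=|\mathbf v|. \tag{7.6}$$ (b) Such an $\omega$ exists if and only if the gauge normalization $h\equiv1$ holds globally: $\mathcal M$ is covered by open sets $O_\alpha$ carrying functions $W_\alpha$ such that the pair $(1,W_\alpha)$ gives $\mathbf F$ on $O_\alpha$ by (1.4), the differences $W_\alpha-W_\beta$ are locally constant on $O_\alpha\cap O_\beta$ (so the $W_\alpha$ are the branches of one multivalued function on $\mathcal M$), and every pair $(h,W)$ giving $\mathbf F$ on an open set $O$ is turned into $(1,W_\alpha)$ near each point of $O\cap O_\alpha$ by a gauge transformation $W\mapsto\rho\circ W$, $h\mapsto(h\circ\rho^{-1})\cdot(\rho'\circ\rho^{-1})$, with $\rho$ a diffeomorphism between open subsets of $\mathbb R$. -/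

import Mathlib

open Set Filter Topology Manifold Bundle
open scoped ContDiff

noncomputable section

namespace NormalShift

/-- The manifold `ℝ⁺` of positive real numbers, an open submanifold of `ℝ`. -/
abbrev PosReal : TopologicalSpace.Opens ℝ := ⟨Set.Ioi 0, isOpen_Ioi⟩

/-- The model with corners of `𝓜 = M × ℝ⁺`, for an `n`-dimensional manifold `M`. -/
abbrev cylModel (n : ℕ) :
    ModelWithCorners ℝ (EuclideanSpace ℝ (Fin n) × ℝ)
      (ModelProd (EuclideanSpace ℝ (Fin n)) ℝ) :=
  (𝓡 n).prod 𝓘(ℝ, ℝ)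

section Cylinder

variable {n : ℕ} {M : Type*} [TopologicalSpace M]
  [ChartedSpace (EuclideanSpace ℝ (Fin n)) M]

/-- The vector `∂/∂v` at a point `q` of `M × ℝ⁺`. -/
def vert (q : M × PosReal) : TangentSpace (cylModel n) q :=
  ((0, 1) : EuclideanSpace ℝ (Fin n) × ℝ)

/-- A vector `u` tangent to `M` at `p`, seen as the vector `(u, 0)` tangent to `M × ℝ⁺` at
`q = (p, v)`. -/
def horiz (q : M × PosReal) (u : TangentSpace (𝓡 n) q.1) : TangentSpace (cylModel n) q :=
  ((u, 0) : EuclideanSpace ℝ (Fin n) × ℝ)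

/-- `horiz` is the differential of the slice inclusion `p ↦ (p, v)`. -/
theorem mfderiv_slice (q : M × PosReal) (u : TangentSpace (𝓡 n) q.1) :
    mfderiv (𝓡 n) (cylModel n) (fun p : M => (p, q.2)) q.1 u = horiz q u := by
  rw [mfderiv_prod_left]; rfl

/-- The differential `dW` at `q` of a function `W` on `M × ℝ⁺`. -/
def differential (W : M × PosReal → ℝ) (q : M × PosReal) :
    TangentSpace (cylModel n) q →L[ℝ] ℝ :=
  mfderiv (cylModel n) 𝓘(ℝ, ℝ) W q

/-- A `1`-form (not necessarily continuous) on `M × ℝ⁺`. -/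
abbrev OneForm (n : ℕ) (M : Type*) [TopologicalSpace M]
    [ChartedSpace (EuclideanSpace ℝ (Fin n)) M] : Type _ :=
  (q : M × PosReal) → (TangentSpace (cylModel n) q →L[ℝ] ℝ)

/-- Smoothness of a `1`-form, as a section of the cotangent bundle. -/
def OneForm.IsSmooth [IsManifold (𝓡 n) ∞ M] (θ : OneForm n M) : Prop :=
  ContMDiff (cylModel n)
    ((cylModel n).prod 𝓘(ℝ, (EuclideanSpace ℝ (Fin n) × ℝ) →L[ℝ] ℝ)) ∞
    (fun q => TotalSpace.mk' ((EuclideanSpace ℝ (Fin n) × ℝ) →L[ℝ] ℝ)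
      (E := fun q : M × PosReal => (TangentSpace (cylModel n) q →L[ℝ] ℝ)) q (θ q))

/-- The coordinate expression of a `1`-form in the chart around `q₀`: the pull-back of the form
under the inverse of the chart. -/
def OneForm.inChart (θ : OneForm n M) (q₀ : M × PosReal)
    (y : EuclideanSpace ℝ (Fin n) × ℝ) :
    (EuclideanSpace ℝ (Fin n) × ℝ) →L[ℝ] ℝ :=
  (θ ((extChartAt (cylModel n) q₀).symm y)).comp
    (mfderiv 𝓘(ℝ, EuclideanSpace ℝ (Fin n) × ℝ) (cylModel n)
      (extChartAt (cylModel n) q₀).symm y)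

/-- Closedness of a `1`-form: `∂θᵢ/∂xʲ = ∂θⱼ/∂xⁱ` on the whole domain of the preferred chart
around each point.  (For smooth forms this is independent of the charts.) -/
def OneForm.IsClosed (θ : OneForm n M) : Prop :=
  ∀ q₀ : M × PosReal, ∀ y ∈ (extChartAt (cylModel n) q₀).target,
    ∀ ξ η : EuclideanSpace ℝ (Fin n) × ℝ,
      fderiv ℝ (θ.inChart q₀) y ξ η = fderiv ℝ (θ.inChart q₀) y η ξ

/-- The gauge transformation near a point `q`: near `q` the pair `(h', W')` is obtained from
`(h, W)` by `W' = ρ ∘ W`, `h' = (h ∘ ρ⁻¹) · (ρ' ∘ ρ⁻¹)`, for a diffeomorphism `ρ` between open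
subsets of the real line, the first of which contains `W q`. -/
def GaugeRelatedAt (q : M × PosReal) (h : ℝ → ℝ) (W : M × PosReal → ℝ)
    (h' : ℝ → ℝ) (W' : M × PosReal → ℝ) : Prop :=
  ∃ ρ : OpenPartialHomeomorph ℝ ℝ,
    ContDiffOn ℝ ∞ ρ ρ.source ∧ ContDiffOn ℝ ∞ ρ.symm ρ.target ∧ W q ∈ ρ.source ∧
    (∀ᶠ x in 𝓝 q, W' x = ρ (W x)) ∧
    ∀ w ∈ ρ.target, h' w = h (ρ.symm w) * deriv ρ (ρ.symm w)

end Cylinder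

section Riemannian

variable {n : ℕ} {M : Type*} [TopologicalSpace M]
  [ChartedSpace (EuclideanSpace ℝ (Fin n)) M]
  [RiemannianBundle (fun x : M => TangentSpace (𝓡 n) x)]

/-- A force field on `M`: a vector `F(p, v)` of `T_pM` for every `p` and every velocity `v` in
`T_pM`.  Only the values at `v ≠ 0` are ever used. -/
abbrev ForceField (n : ℕ) (M : Type*) [TopologicalSpace M]
    [ChartedSpace (EuclideanSpace ℝ (Fin n)) M] : Type _ :=
  (p : M) → TangentSpace (𝓡 n) p → TangentSpace (𝓡 n) p

/-- The point `(p, |v|)` of `M × ℝ⁺` given by a non-zero vector `v` at `p`. -/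
def speedPoint (p : M) (v : TangentSpace (𝓡 n) p) (hv : v ≠ 0) : M × PosReal :=
  (p, ⟨‖v‖, norm_pos_iff.mpr hv⟩)

/-- The unit vector `N = v / |v|`. -/
def unitVec (p : M) (v : TangentSpace (𝓡 n) p) : TangentSpace (𝓡 n) p := ‖v‖⁻¹ • v

/-- The contraction with `u` of the covector
`c Nₖ / α_{n+1} - |v| ∑ᵢ (αᵢ / α_{n+1}) (2 Nⁱ Nₖ - δⁱₖ)`,
where `α = (α₁, …, αₙ, α_{n+1})` is a covector at the point `(p, |v|)` of `M × ℝ⁺`. -/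
def forceExpr (c : ℝ) (p : M) (v : TangentSpace (𝓡 n) p) (hv : v ≠ 0)
    (α : TangentSpace (cylModel n) (speedPoint p v hv) →L[ℝ] ℝ)
    (u : TangentSpace (𝓡 n) p) : ℝ :=
  let q := speedPoint p v hv
  let N := unitVec p v
  c * inner ℝ N u / α (vert q)
    - ‖v‖ * ((2 * α (horiz q N) * inner ℝ N u - α (horiz q u)) / α (vert q))

/-- On the open set `O ⊆ M × ℝ⁺`, the force field `F` is given by the pair `(h, W)`: `W` is smooth
on `O` with `∂W/∂v ≠ 0`, `h` is smooth on the set of values of `W`, and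
`Fₖ = h(W) Nₖ / W_v - |v| ∑ᵢ (∇ᵢW / W_v) (2 Nⁱ Nₖ - δⁱₖ)`
for all non-zero velocities `v` at `p` with `(p, |v|) ∈ O`. -/
structure IsRepresentedOn (F : ForceField n M) (O : Set (M × PosReal))
    (h : ℝ → ℝ) (W : M × PosReal → ℝ) : Prop where
  isOpen : IsOpen O
  smooth_W : ContMDiffOn (cylModel n) 𝓘(ℝ, ℝ) ∞ W O
  smooth_h : ContDiffOn ℝ ∞ h (W '' O)
  deriv_ne : ∀ q ∈ O, differential (n := n) W q (vert q) ≠ 0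
  formula : ∀ (p : M) (v : TangentSpace (𝓡 n) p) (hv : v ≠ 0), speedPoint p v hv ∈ O →
    ∀ u : TangentSpace (𝓡 n) p,
      inner ℝ (F p v) u =
        forceExpr (h (W (speedPoint p v hv))) p v hv (differential W (speedPoint p v hv)) u

/-- The force fields of the Newtonian dynamical systems admitting the normal shift: near each point
of `M × ℝ⁺` they are given by a pair `(h, W)`, which may change from point to point. -/
def IsNormalShiftForce (F : ForceField n M) : Prop :=
  ∀ q : M × PosReal, ∃ (O : Set (M × PosReal)) (h : ℝ → ℝ) (W : M × PosReal → ℝ),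
    q ∈ O ∧ IsRepresentedOn F O h W

/-- The covector and the coefficient in `forceExpr` can be recovered, up to the obvious scaling. -/
theorem forceExpr_determines (hn : 1 ≤ n) (c c' : M × PosReal → ℝ) (α α' : OneForm n M)
    (q : M × PosReal)
    (h : ∀ (p : M) (v : TangentSpace (𝓡 n) p) (hv : v ≠ 0), speedPoint p v hv = q →
      ∀ u, forceExpr (c (speedPoint p v hv)) p v hv (α (speedPoint p v hv)) u =
        forceExpr (c' (speedPoint p v hv)) p v hv (α' (speedPoint p v hv)) u) :
    c q / α q (vert q) = c' q / α' q (vert q) ∧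
      ∀ u, α q (horiz q u) / α q (vert q) = α' q (horiz q u) / α' q (vert q) := by
  obtain ⟨p, r, hr⟩ := q
  have hr' : (0 : ℝ) < r := hr
  have key : ∀ N : TangentSpace (𝓡 n) p, ‖N‖ = 1 →
      c (p, ⟨r, hr⟩) / α (p, ⟨r, hr⟩) (vert _) = c' (p, ⟨r, hr⟩) / α' (p, ⟨r, hr⟩) (vert _) ∧
      α (p, ⟨r, hr⟩) (horiz _ N) / α (p, ⟨r, hr⟩) (vert _) =
        α' (p, ⟨r, hr⟩) (horiz _ N) / α' (p, ⟨r, hr⟩) (vert _) := by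
    intro N hN
    have aux : ∀ N : TangentSpace (𝓡 n) p, ‖N‖ = 1 →
        c (p, ⟨r, hr⟩) / α (p, ⟨r, hr⟩) (vert _) -
          r * (α (p, ⟨r, hr⟩) (horiz _ N) / α (p, ⟨r, hr⟩) (vert _)) =
        c' (p, ⟨r, hr⟩) / α' (p, ⟨r, hr⟩) (vert _) -
          r * (α' (p, ⟨r, hr⟩) (horiz _ N) / α' (p, ⟨r, hr⟩) (vert _)) := by
      intro N hN
      have hnorm : ‖r • N‖ = r := by rw [norm_smul, hN, Real.norm_of_nonneg hr'.le, mul_one]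
      have hv : r • N ≠ 0 := by
        rw [← norm_pos_iff, hnorm]; exact hr'
      have hq : speedPoint p (r • N) hv = (p, ⟨r, hr⟩) := by
        simp only [speedPoint, hnorm]
      have hu : unitVec p (r • N) = N := by
        rw [unitVec, hnorm, smul_smul, inv_mul_cancel₀ hr'.ne', one_smul]
      have hNN : inner ℝ N N = (1 : ℝ) := by
        rw [real_inner_self_eq_norm_sq, hN]; norm_num
      have e := h p (r • N) hv hq N
      have e1 : ∀ (c : M × PosReal → ℝ) (α : OneForm n M),
          forceExpr (c (speedPoint p (r • N) hv)) p (r • N) hv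
            (α (speedPoint p (r • N) hv)) N =
          c (p, ⟨r, hr⟩) / α (p, ⟨r, hr⟩) (vert _) -
          r * (α (p, ⟨r, hr⟩) (horiz _ N) / α (p, ⟨r, hr⟩) (vert _)) := by
        intro c α
        simp only [forceExpr, hu, hNN, hnorm]
        rw [hq]
        ring
      rw [e1, e1] at e
      exact e
    have a1 := aux N hN
    have a2 := aux (-N) (by rw [norm_neg, hN])
    have hneg : horiz (n := n) ((p, ⟨r, hr⟩) : M × PosReal) (-N) = -horiz (p, ⟨r, hr⟩) N := by
      have : ∀ x : EuclideanSpace ℝ (Fin n), ((-x, 0) : EuclideanSpace ℝ (Fin n) × ℝ) = -(x, 0) :=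
        fun x => by ext <;> simp
      exact this N
    rw [hneg, map_neg, map_neg, neg_div, neg_div] at a2
    refine ⟨by linarith, ?_⟩
    exact mul_left_cancel₀ hr'.ne' (by linarith)
  have hE : ∃ u : TangentSpace (𝓡 n) p, u ≠ 0 := by
    refine ⟨(EuclideanSpace.single ⟨0, hn⟩ (1 : ℝ) : EuclideanSpace ℝ (Fin n)), fun h0 => ?_⟩
    have : (EuclideanSpace.single ⟨0, hn⟩ (1 : ℝ) : EuclideanSpace ℝ (Fin n)) = 0 := h0
    simp at this
  have hunit : ∀ u : TangentSpace (𝓡 n) p, u ≠ 0 → ‖‖u‖⁻¹ • u‖ = 1 := by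
    intro u hu
    rw [norm_smul, norm_inv, norm_norm, inv_mul_cancel₀ (norm_ne_zero_iff.mpr hu)]
  refine ⟨?_, fun u => ?_⟩
  · obtain ⟨u, hu⟩ := hE
    exact (key _ (hunit u hu)).1
  · have hsmul : ∀ (a : ℝ) (w : TangentSpace (𝓡 n) p),
        horiz (n := n) ((p, ⟨r, hr⟩) : M × PosReal) (a • w) = a • horiz (p, ⟨r, hr⟩) w := by
      intro a w
      have : ∀ x : EuclideanSpace ℝ (Fin n),
          ((a • x, 0) : EuclideanSpace ℝ (Fin n) × ℝ) = a • (x, 0) := fun x => by ext <;> simp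
      exact this w
    by_cases hu : u = 0
    · subst hu
      have h0 := hsmul 0 0
      rw [zero_smul, zero_smul] at h0
      have h0' : horiz (n := n) ((p, ⟨r, hr⟩) : M × PosReal) 0 = 0 := h0
      simp only [h0', map_zero, zero_div]
    · have k := (key _ (hunit u hu)).2
      have hn0 : ‖u‖⁻¹ ≠ 0 := inv_ne_zero (norm_ne_zero_iff.mpr hu)
      rw [hsmul, map_smul, map_smul, smul_eq_mul, smul_eq_mul, mul_div_assoc, mul_div_assoc] at k
      exact mul_left_cancel₀ hn0 k

theorem IsRepresentedOn.agree (hn : 1 ≤ n) {F : ForceField n M} {O O' : Set (M × PosReal)}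
    {h h' : ℝ → ℝ} {W W' : M × PosReal → ℝ} (H : IsRepresentedOn F O h W)
    (H' : IsRepresentedOn F O' h' W') {q : M × PosReal} (hq : q ∈ O) (hq' : q ∈ O') :
    h (W q) / differential (n := n) W q (vert q) =
      h' (W' q) / differential (n := n) W' q (vert q) ∧
    ∀ u, differential (n := n) W q (horiz q u) / differential (n := n) W q (vert q) =
      differential (n := n) W' q (horiz q u) / differential (n := n) W' q (vert q) := by
  refine forceExpr_determines hn (fun q => h (W q)) (fun q => h' (W' q))
    (differential W) (differential W') q (fun p v hv e u => ?_)
  rw [← H.formula p v hv (by rw [e]; exact hq), ← H'.formula p v hv (by rw [e]; exact hq')]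

/-- The function `h` of a pair chosen near `q`. -/
def IsNormalShiftForce.h {F : ForceField n M} (hF : IsNormalShiftForce F) (q : M × PosReal) :
    ℝ → ℝ :=
  (hF q).choose_spec.choose

/-- The function `W` of a pair chosen near `q`. -/
def IsNormalShiftForce.W {F : ForceField n M} (hF : IsNormalShiftForce F) (q : M × PosReal) :
    M × PosReal → ℝ :=
  (hF q).choose_spec.choose_spec.choose

/-- The distribution `U = Ker σ` attached to `F`, where `σ` is the section of the projectivized
cotangent bundle of `M × ℝ⁺` represented locally by `dW`.  By `attachedDistribution_eq`
it does not depend on the choice of the pairs. -/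
def attachedDistribution {F : ForceField n M} (hF : IsNormalShiftForce F) (q : M × PosReal) :
    Submodule ℝ (TangentSpace (cylModel n) q) :=
  LinearMap.ker (differential (n := n) (hF.W q) q).toLinearMap

/-- The section `s` of the quotient bundle `T(M × ℝ⁺) / U` attached to `F`: the class of the
vector field `(h(W) / W_v) ∂/∂v`.  By `attachedSection_eq` it does not depend on the choice of
the pairs. -/
def attachedSection {F : ForceField n M} (hF : IsNormalShiftForce F) (q : M × PosReal) :
    TangentSpace (cylModel n) q ⧸ attachedDistribution hF q :=
  (attachedDistribution hF q).mkQ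
    ((hF.h q (hF.W q q) / differential (n := n) (hF.W q) q (vert q)) • vert q)

theorem IsNormalShiftForce.chosen {F : ForceField n M} (hF : IsNormalShiftForce F)
    (q : M × PosReal) : ∃ O, q ∈ O ∧ IsRepresentedOn F O (hF.h q) (hF.W q) :=
  ⟨(hF q).choose, (hF q).choose_spec.choose_spec.choose_spec⟩

/-- `U = Ker dW` for every pair `(h, W)` giving `F` near the point. -/
theorem attachedDistribution_eq (hn : 1 ≤ n) {F : ForceField n M} (hF : IsNormalShiftForce F)
    {O : Set (M × PosReal)} {h : ℝ → ℝ} {W : M × PosReal → ℝ} (H : IsRepresentedOn F O h W)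
    {q : M × PosReal} (hq : q ∈ O) :
    attachedDistribution hF q = LinearMap.ker (differential (n := n) W q).toLinearMap := by
  obtain ⟨O', hq', H'⟩ := hF.chosen q
  have e := (H'.agree hn H hq' hq).2
  have d := H.deriv_ne q hq
  have d' := H'.deriv_ne q hq'
  have dec : ∀ ξ : TangentSpace (cylModel n) q,
      ∃ (u : TangentSpace (𝓡 n) q.1) (t : ℝ), ξ = horiz q u + t • vert q := by
    intro ξ
    have : ∀ ξ : EuclideanSpace ℝ (Fin n) × ℝ, ξ = (ξ.1, 0) + ξ.2 • (0, 1) := by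
      intro ξ; ext <;> simp
    exact ⟨(show EuclideanSpace ℝ (Fin n) × ℝ from ξ).1,
      (show EuclideanSpace ℝ (Fin n) × ℝ from ξ).2, this ξ⟩
  ext ξ
  obtain ⟨u, t, rfl⟩ := dec ξ
  have eu := e u
  simp only [attachedDistribution, LinearMap.mem_ker, ContinuousLinearMap.coe_coe, map_add,
    map_smul, smul_eq_mul]
  rw [div_eq_div_iff d' d] at eu
  constructor
  · intro hz
    refine mul_right_cancel₀ d' ?_
    linear_combination -eu + differential (n := n) W q (vert q) * hz
  · intro hz
    refine mul_right_cancel₀ d ?_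
    linear_combination eu + differential (n := n) (hF.W q) q (vert q) * hz

/-- `s` is the class of `(h(W) / W_v) ∂/∂v` for every pair `(h, W)` giving `F` near the point. -/
theorem attachedSection_eq (hn : 1 ≤ n) {F : ForceField n M} (hF : IsNormalShiftForce F)
    {O : Set (M × PosReal)} {h : ℝ → ℝ} {W : M × PosReal → ℝ} (H : IsRepresentedOn F O h W)
    {q : M × PosReal} (hq : q ∈ O) :
    attachedSection hF q = (attachedDistribution hF q).mkQ
      ((h (W q) / differential (n := n) W q (vert q)) • vert q) := by
  obtain ⟨O', hq', H'⟩ := hF.chosen q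
  rw [attachedSection, (H'.agree hn H hq' hq).1]

/-- The `1`-form `θ` determines the force field `F`: its component `θ_{n+1}` does not vanish, and
`Fₖ = Nₖ / θ_{n+1} - |v| ∑ᵢ (θᵢ / θ_{n+1}) (2 Nⁱ Nₖ - δⁱₖ)` for all non-zero velocities. -/
structure OneForm.Determines (θ : OneForm n M) (F : ForceField n M) : Prop where
  vert_ne : ∀ q, θ q (vert q) ≠ 0
  formula : ∀ (p : M) (v : TangentSpace (𝓡 n) p) (hv : v ≠ 0) (u : TangentSpace (𝓡 n) p),
    inner ℝ (F p v) u = forceExpr 1 p v hv (θ (speedPoint p v hv)) u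

/-- The gauge normalization `h ≡ 1` holds globally: `M × ℝ⁺` is covered by open sets `O q` with
pairs `(1, W q)` giving `F` on `O q`; on overlaps the functions `W q` differ by locally constant
functions, so that they are the branches of one multivalued function on `M × ℝ⁺`; and any pair
giving `F` is turned into them by gauge transformations. -/
def IsGloballyNormalized (F : ForceField n M) : Prop :=
  ∃ (O : M × PosReal → Set (M × PosReal)) (W : M × PosReal → M × PosReal → ℝ),
    (∀ q, q ∈ O q ∧ IsRepresentedOn F (O q) (fun _ => 1) (W q)) ∧
    (∀ q q', ∀ x ∈ O q ∩ O q', ∃ c : ℝ, ∀ᶠ y in 𝓝 x, W q y = W q' y + c) ∧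
    (∀ (O' : Set (M × PosReal)) (h' : ℝ → ℝ) (W' : M × PosReal → ℝ),
      IsRepresentedOn F O' h' W' →
        ∀ q, ∀ x ∈ O q ∩ O', GaugeRelatedAt x h' W' (fun _ => 1) (W q))

end Riemannian

end NormalShift

end

/-! The formula for `F` sees a pair `(h, W)` only through the ratios `h(W)/W_v` and `∇ᵢW/W_v`.
Contracting with a unit vector `N` at velocity `vN`, then replacing `N` by `-N`, separates the two
(`IsRepresentedOn.agree`; a unit vector exists because `n ≥ 1`). So any two pairs satisfy `h'(W') dW
= h(W) dW'` where both are defined (`IsRepresentedOn.smul_differential_eq`).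

Since `W_v ≠ 0`, the vector `∂/∂v` is not in `Ker dW`, and `s ≠ 0` means exactly `h(W) ≠ 0`. In that
case the local forms `dW / h(W)` agree on overlaps and define one global form. It is closed, being a
function of `W` times `dW`, and dividing the covector by `h(W)` replaces the coefficient `h(W)` in
the force formula by `1`. This is (a).

For (b), a closed form determining `F` has local primitives `W` by the Poincaré lemma, and each `(1,
W)` gives `F`. Primitives of the same form differ by local constants. For another pair `(h', W')`
the relation above reads `dW = dW' / h'(W')`, so a solution of `ρ' = 1/h'` makes `ρ ∘ W'` equal to
`W` up to a constant, which the initial value of `ρ` removes (`IsRepresentedOn.gaugeRelatedAt`).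
Conversely, pairs with `h = 1` force `s ≠ 0` everywhere, and (a) supplies the form. -/

noncomputable section

namespace NormalShift

/-! ### Smooth sections of the cotangent bundle in charts -/

section Generic

variable {E : Type*} [NormedAddCommGroup E] [NormedSpace ℝ E] {H : Type*} [TopologicalSpace H]
  (I : ModelWithCorners ℝ E H) {X : Type*} [TopologicalSpace X] [ChartedSpace H X]

/-- The coordinate expression of a `1`-form in the extended chart around `x₀`. -/
def chartForm (θ : (x : X) → TangentSpace I x →L[ℝ] ℝ) (x₀ : X) (y : E) : E →L[ℝ] ℝ :=
  (θ ((extChartAt I x₀).symm y)).comp (mfderiv 𝓘(ℝ, E) I (extChartAt I x₀).symm y)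

/-- Identifies the fibre coordinate in the hom-bundle with the pull-back under the inverse chart:
the tangent trivialization is inverted by the derivative of the inverse chart, and the trivial
factor contributes the identity. -/
theorem trivializationAt_cotangent [I.Boundaryless] [IsManifold I ∞ X]
    (θ : (x : X) → TangentSpace I x →L[ℝ] ℝ) {x₀ x : X} (hx : x ∈ (extChartAt I x₀).source) :
    (trivializationAt (E →L[ℝ] ℝ) (fun x : X => TangentSpace I x →L[ℝ] ℝ) x₀
      (TotalSpace.mk' (E →L[ℝ] ℝ) (E := fun x : X => TangentSpace I x →L[ℝ] ℝ) x (θ x))).2 =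
      chartForm I θ x₀ (extChartAt I x₀ x) := by
  have hx' : x ∈ (chartAt H x₀).source := by rwa [extChartAt_source] at hx
  have : IsManifold I 1 X := .of_le (n := ∞) (by simp)
  have h := TangentBundle.symmL_trivializationAt (I := I) hx'
  rw [I.range_eq_univ, mfderivWithin_univ] at h
  have e : (trivializationAt (E →L[ℝ] ℝ) (fun x : X => TangentSpace I x →L[ℝ] ℝ) x₀
      (TotalSpace.mk' (E →L[ℝ] ℝ) (E := fun x : X => TangentSpace I x →L[ℝ] ℝ) x (θ x))).2 =
      ((trivializationAt ℝ (Bundle.Trivial X ℝ) x₀).continuousLinearMapAt ℝ x).comp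
        ((θ x).comp ((trivializationAt E (TangentSpace I) x₀).symmL ℝ x)) := rfl
  have e2 : (trivializationAt ℝ (Bundle.Trivial X ℝ) x₀).continuousLinearMapAt ℝ x =
    ContinuousLinearMap.id ℝ ℝ := Bundle.Trivial.continuousLinearMapAt_trivialization ℝ X ℝ x
  rw [e, e2, h]
  -- The point obtained by going to the chart and back equals `x` only propositionally, so the
  -- covector there has another type; a free `x'` lets the equality be substituted.
  have key : ∀ x' : X, x' = x → (ContinuousLinearMap.id ℝ ℝ).comp ((θ x).comp
      (mfderiv 𝓘(ℝ, E) I (extChartAt I x₀).symm (extChartAt I x₀ x) : E →L[ℝ] E)) =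
      (θ x').comp (mfderiv 𝓘(ℝ, E) I (extChartAt I x₀).symm (extChartAt I x₀ x) : E →L[ℝ] E) := by
    rintro _ rfl
    rfl
  exact key _ ((extChartAt I x₀).left_inv hx)

/-- Bridge from bundle smoothness to calculus in the model space: over a chart domain, smoothness of
a section is smoothness of its fibre coordinate, and charts are smooth in both directions. -/
theorem contMDiff_form_iff [I.Boundaryless] [IsManifold I ∞ X]
    (θ : (x : X) → TangentSpace I x →L[ℝ] ℝ) :
    ContMDiff I (I.prod 𝓘(ℝ, E →L[ℝ] ℝ)) ∞
      (fun x => TotalSpace.mk' (E →L[ℝ] ℝ) (E := fun x : X => TangentSpace I x →L[ℝ] ℝ) x (θ x)) ↔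
    ∀ x₀, ContDiffOn ℝ ∞ (chartForm I θ x₀) (extChartAt I x₀).target := by
  have hb : ∀ x₀ : X, (trivializationAt (E →L[ℝ] ℝ)
      (fun x : X => TangentSpace I x →L[ℝ] ℝ) x₀).baseSet = (extChartAt I x₀).source := by
    intro x₀
    rw [extChartAt_source]
    exact Set.inter_univ _
  have hm := fun x₀ : X => contMDiffOn_extChartAt_symm (I := I) (n := ∞) x₀
  have hp := fun x₀ : X => contMDiffOn_extChartAt (I := I) (n := ∞) (x := x₀)
  have main : ∀ x₀ : X, ContMDiffOn I (I.prod 𝓘(ℝ, E →L[ℝ] ℝ)) ∞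
      (fun x => TotalSpace.mk' (E →L[ℝ] ℝ) (E := fun x : X => TangentSpace I x →L[ℝ] ℝ) x (θ x))
      (extChartAt I x₀).source ↔
      ContDiffOn ℝ ∞ (chartForm I θ x₀) (extChartAt I x₀).target := by
    intro x₀
    rw [← hb x₀, Trivialization.contMDiffOn_section_baseSet_iff, hb x₀]
    have hc := contMDiffOn_congr (I := I) (I' := 𝓘(ℝ, E →L[ℝ] ℝ)) (n := ∞)
      (fun x hx => trivializationAt_cotangent I θ (x₀ := x₀) (x := x) hx)
    rw [hc, ← contMDiffOn_iff_contDiffOn]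
    constructor
    · intro h
      refine (h.comp (hm x₀) (fun y hy => (extChartAt I x₀).map_target hy)).congr ?_
      intro y hy
      simp only [Function.comp_apply, (extChartAt I x₀).right_inv hy]
    · intro h
      refine h.comp (t := (extChartAt I x₀).target) ?_
        (fun y hy => (extChartAt I x₀).map_source hy)
      rw [extChartAt_source]
      exact hp x₀
  simp_rw [← main]
  refine ⟨fun h x₀ => h.contMDiffOn, fun h x => ?_⟩
  exact (h x x (mem_extChartAt_source x)).contMDiffAt (extChartAt_source_mem_nhds x)

end Generic

/-! ### Calculus in the model space: the gauge function, closedness, primitives -/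

/-- A solution `ρ` of `ρ' = 1 / h`, `ρ a = b`, near a point `a` with `h a ≠ 0`. -/
theorem exists_openPartialHomeomorph_deriv_eq_inv {h : ℝ → ℝ} {S : Set ℝ} {a : ℝ} (b : ℝ)
    (hS : S ∈ 𝓝 a) (hh : ContDiffOn ℝ ∞ h S) (ha : h a ≠ 0) :
    ∃ ρ : OpenPartialHomeomorph ℝ ℝ, ContDiffOn ℝ ∞ ρ ρ.source ∧
      ContDiffOn ℝ ∞ ρ.symm ρ.target ∧ a ∈ ρ.source ∧ ρ a = b ∧
      ∀ w ∈ ρ.source, h w ≠ 0 ∧ HasDerivAt ρ (h w)⁻¹ w := by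
  have hc : ContinuousAt h a := (hh.contDiffAt hS).continuousAt
  obtain ⟨r, hr, hball⟩ := Metric.mem_nhds_iff.mp (inter_mem hS (hc.eventually_ne ha))
  have hd : ContDiffOn ℝ ∞ (fun w => (h w)⁻¹) (Metric.ball a r) :=
    (hh.mono fun w hw => (hball hw).1).inv fun w hw => (hball hw).2
  obtain ⟨R₀, hR₀⟩ := (convex_ball a r).exists_forall_hasDerivWithinAt
    (hd.differentiableOn (by simp))
  -- The integration constant is fixed so that `R a = b`.
  set R : ℝ → ℝ := fun w => R₀ w - R₀ a + b with hRdef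
  have hR : ∀ w ∈ Metric.ball a r, HasDerivAt R (h w)⁻¹ w := fun w hw =>
    (((hR₀ w hw).hasDerivAt (Metric.isOpen_ball.mem_nhds hw)).sub_const _).add_const _
  have hRs : ContDiffOn ℝ ∞ R (Metric.ball a r) := by
    rw [contDiffOn_infty_iff_deriv_of_isOpen Metric.isOpen_ball]
    exact ⟨fun w hw => (hR w hw).differentiableAt.differentiableWithinAt,
      hd.congr fun w hw => (hR w hw).deriv⟩
  have haB : a ∈ Metric.ball a r := Metric.mem_ball_self hr
  have hRa : ContDiffAt ℝ ∞ R a := hRs.contDiffAt (Metric.isOpen_ball.mem_nhds haB)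
  let ρ₀ := hRa.toOpenPartialHomeomorph R
    (f' := ContinuousLinearEquiv.unitsEquivAut ℝ (Units.mk0 _ (inv_ne_zero ha)))
    ((hR a haB).hasFDerivAt_equiv (inv_ne_zero ha)) (by simp)
  -- The inverse function theorem does not control its source; cutting down to the ball makes `ρ' =
  -- 1/h` and `h ≠ 0` hold on all of it.
  let ρ := ρ₀.restrOpen (Metric.ball a r) Metric.isOpen_ball
  have hρ : ∀ w, ρ w = R w := fun _ => rfl
  have hsrc : ∀ w ∈ ρ.source, w ∈ Metric.ball a r := fun w hw => hw.2
  have hder : ∀ w ∈ ρ.source, HasDerivAt ρ (h w)⁻¹ w := fun w hw => hR w (hsrc w hw)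
  refine ⟨ρ, hRs.mono hsrc, ?_, ⟨hRa.mem_toOpenPartialHomeomorph_source _ _, haB⟩, ?_,
    fun w hw => ⟨(hball (hsrc w hw)).2, hder w hw⟩⟩
  · intro w hw
    have hw' := ρ.map_target hw
    refine (ρ.contDiffAt_symm_deriv (inv_ne_zero (hball (hsrc _ hw')).2) hw (hder _ hw')
      (hRs.contDiffAt (Metric.isOpen_ball.mem_nhds (hsrc _ hw')))).contDiffWithinAt
  · rw [hρ, hRdef]; simp

/-- The derivative of `k dw` is `dk ⊗ dw + k D²w`. The first term is symmetric because `dk` is a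
multiple of `dw`, the second because second derivatives commute. This is the closedness of `dW /
h(W)`. -/
theorem fderiv_smul_fderiv_symm {E : Type*} [NormedAddCommGroup E] [NormedSpace ℝ E]
    {w k : E → ℝ} {y : E} (hw : ContDiffAt ℝ ∞ w y) (a : ℝ)
    (hk : HasFDerivAt k (a • fderiv ℝ w y) y) (ξ η : E) :
    fderiv ℝ (fun z => k z • fderiv ℝ w z) y ξ η =
      fderiv ℝ (fun z => k z • fderiv ℝ w z) y η ξ := by
  have h2 : (2 : WithTop ℕ∞) ≤ ∞ :=
    WithTop.coe_le_coe.2 (le_top : (2 : ℕ∞) ≤ ⊤)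
  have hd : DifferentiableAt ℝ (fderiv ℝ w) y :=
    (hw.fderiv_right (m := 1) (by norm_num; exact h2)).differentiableAt (by simp)
  have hs : IsSymmSndFDerivAt ℝ w y := hw.isSymmSndFDerivAt (by simpa using h2)
  rw [(hk.fun_smul hd.hasFDerivAt).fderiv]
  have := hs.eq ξ η
  simp [this, mul_comm, mul_left_comm]

/-- The Poincaré lemma in a ball around a given point. -/
theorem exists_primitive_near {E : Type*} [NormedAddCommGroup E] [NormedSpace ℝ E]
    {θ : E → E →L[ℝ] ℝ} {s : Set E} {y : E} (hs : s ∈ 𝓝 y)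
    (hθ : ContDiffOn ℝ ∞ θ s) (hc : ∀ z ∈ s, ∀ ξ η, fderiv ℝ θ z ξ η = fderiv ℝ θ z η ξ) :
    ∃ (B : Set E) (f : E → ℝ), IsOpen B ∧ y ∈ B ∧ B ⊆ s ∧ ContDiffOn ℝ ∞ f B ∧
      ∀ z ∈ B, HasFDerivAt f (θ z) z := by
  obtain ⟨r, hr, hball⟩ := Metric.mem_nhds_iff.mp hs
  obtain ⟨f, hf⟩ := (convex_ball y r).exists_forall_hasFDerivAt_of_fderiv_symmetric
    Metric.isOpen_ball ((hθ.mono hball).differentiableOn (by simp))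
    (fun z hz => hc z (hball hz))
  refine ⟨_, f, Metric.isOpen_ball, Metric.mem_ball_self hr, hball, ?_, hf⟩
  rw [contDiffOn_infty_iff_fderiv_of_isOpen Metric.isOpen_ball]
  exact ⟨fun z hz => (hf z hz).differentiableAt.differentiableWithinAt,
    (hθ.mono hball).congr fun z hz => (hf z hz).fderiv⟩

/-! ### Functions on a manifold and their differentials in charts -/

section Generic

variable {E : Type*} [NormedAddCommGroup E] [NormedSpace ℝ E] {H : Type*} [TopologicalSpace H]
  {I : ModelWithCorners ℝ E H} {X : Type*} [TopologicalSpace X] [ChartedSpace H X]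

theorem continuousAt_extChartAt_symm_of_mem [I.Boundaryless] {x₀ : X} {y : E}
    (hy : y ∈ (extChartAt I x₀).target) : ContinuousAt (extChartAt I x₀).symm y :=
  (continuousOn_extChartAt_symm x₀).continuousAt ((isOpen_extChartAt_target x₀).mem_nhds hy)

/-- The pull-back of a germ from the chart to the manifold. -/
theorem eventually_of_extChartAt {p : X → Prop} (x : X)
    (h : ∀ᶠ y in 𝓝 (extChartAt I x x), p ((extChartAt I x).symm y)) : ∀ᶠ x' in 𝓝 x, p x' := by
  filter_upwards [(continuousAt_extChartAt (I := I) x).eventually h,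
    extChartAt_source_mem_nhds (I := I) x] with x' hx' hs
  rwa [(extChartAt I x).left_inv hs] at hx'

theorem eventually_symm_of_eventually [I.Boundaryless] {p : X → Prop} {x₀ : X} {y : E}
    (hy : y ∈ (extChartAt I x₀).target) (h : ∀ᶠ x in 𝓝 ((extChartAt I x₀).symm y), p x) :
    ∀ᶠ y' in 𝓝 y, p ((extChartAt I x₀).symm y') ∧ y' ∈ (extChartAt I x₀).target :=
  ((continuousAt_extChartAt_symm_of_mem hy).eventually h).and
    ((isOpen_extChartAt_target x₀).mem_nhds hy)

variable [I.Boundaryless] [IsManifold I ∞ X]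

theorem chartForm_mfderiv {W : X → ℝ} {x₀ : X} {y : E} (hy : y ∈ (extChartAt I x₀).target)
    (hW : MDifferentiableAt I 𝓘(ℝ, ℝ) W ((extChartAt I x₀).symm y)) :
    chartForm I (fun x => mfderiv I 𝓘(ℝ, ℝ) W x) x₀ y =
      fderiv ℝ (W ∘ (extChartAt I x₀).symm) y := by
  have : IsManifold I 1 X := .of_le (n := ∞) (by simp)
  have h := mdifferentiableWithinAt_extChartAt_symm hy
  rw [I.range_eq_univ, mdifferentiableWithinAt_univ] at h
  rw [← mfderiv_eq_fderiv, mfderiv_comp y hW h]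
  rfl

theorem contDiffAt_comp_extChartAt_symm {W : X → ℝ} {x₀ : X} {y : E}
    (hy : y ∈ (extChartAt I x₀).target)
    (hW : ContMDiffAt I 𝓘(ℝ, ℝ) ∞ W ((extChartAt I x₀).symm y)) :
    ContDiffAt ℝ ∞ (W ∘ (extChartAt I x₀).symm) y := by
  rw [← contMDiffAt_iff_contDiffAt]
  exact hW.comp y ((contMDiffOn_extChartAt_symm x₀).contMDiffAt
    ((isOpen_extChartAt_target x₀).mem_nhds hy))

/-- Carries a primitive found in the chart back to the manifold: the derivatives of the chart and
its inverse cancel. -/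
theorem mfderiv_comp_extChartAt {G : E → ℝ} {θ : (x : X) → TangentSpace I x →L[ℝ] ℝ} {x₀ x : X}
    (hx : x ∈ (extChartAt I x₀).source)
    (hG : HasFDerivAt G (chartForm I θ x₀ (extChartAt I x₀ x)) (extChartAt I x₀ x)) :
    mfderiv I 𝓘(ℝ, ℝ) (G ∘ extChartAt I x₀) x = θ x := by
  have : IsManifold I 1 X := .of_le (n := ∞) (by simp)
  have hx' : x ∈ (chartAt H x₀).source := by rwa [extChartAt_source] at hx
  rw [mfderiv_comp x hG.differentiableAt.mdifferentiableAt (mdifferentiableAt_extChartAt hx'),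
    mfderiv_eq_fderiv, hG.fderiv]
  have h := mfderivWithin_extChartAt_symm_comp_mfderiv_extChartAt' (I := I) hx
  rw [I.range_eq_univ, mfderivWithin_univ] at h
  have key : ∀ x' : X, x' = x → ∀ A : E →L[ℝ] E, ∀ B : E →L[ℝ] E, A.comp B = .id ℝ E →
      ContinuousLinearMap.comp (ContinuousLinearMap.comp (show E →L[ℝ] ℝ from θ x') A) B =
        (show E →L[ℝ] ℝ from θ x) := by
    rintro _ rfl A B hAB
    rw [ContinuousLinearMap.comp_assoc, hAB, ContinuousLinearMap.comp_id]
  exact key _ ((extChartAt I x₀).left_inv hx) _ _ h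

/-- A nonzero functional is onto `ℝ`, so `W` is a submersion at `x` and hence open there. It ensures
that `h`, smooth only on the set of values of `W`, is smooth on a neighbourhood of `W x`. -/
theorem image_mem_nhds_of_mfderiv_ne_zero [CompleteSpace E] {W : X → ℝ} {x : X}
    (hW : ContMDiffAt I 𝓘(ℝ, ℝ) ∞ W x) (hd : mfderiv I 𝓘(ℝ, ℝ) W x ≠ 0)
    {O : Set X} (hO : O ∈ 𝓝 x) : W '' O ∈ 𝓝 (W x) := by
  set y := extChartAt I x x with hydef
  have hy : y ∈ (extChartAt I x).target := mem_extChartAt_target x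
  have hyx : (extChartAt I x).symm y = x := extChartAt_to_inv x
  have hWy : ContMDiffAt I 𝓘(ℝ, ℝ) ∞ W ((extChartAt I x).symm y) := by rwa [hyx]
  have hc := contDiffAt_comp_extChartAt_symm hy hWy
  have hne : fderiv ℝ (W ∘ (extChartAt I x).symm) y ≠ 0 := by
    intro h0
    apply hd
    have h1 := mfderiv_comp_extChartAt (G := W ∘ (extChartAt I x).symm)
      (θ := fun x => mfderiv I 𝓘(ℝ, ℝ) W x) (mem_extChartAt_source (I := I) x) (by
        rw [chartForm_mfderiv hy (hWy.mdifferentiableAt (by simp))]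
        exact (hc.differentiableAt (by simp)).hasFDerivAt)
    have h2 := mfderiv_comp x (g := W ∘ (extChartAt I x).symm) (f := extChartAt I x)
      (I' := 𝓘(ℝ, E)) (I := I) (I'' := 𝓘(ℝ, ℝ))
      (hc.differentiableAt (by simp)).mdifferentiableAt
      (by
        have : IsManifold I 1 X := .of_le (n := ∞) (by simp)
        exact mdifferentiableAt_extChartAt (mem_chart_source H x))
    rw [← h1, h2, mfderiv_eq_fderiv, h0]
    exact ContinuousLinearMap.zero_comp _
  have hsurj : (fderiv ℝ (W ∘ (extChartAt I x).symm) y).range = ⊤ := by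
    rw [LinearMap.range_eq_top]
    exact LinearMap.surjective (fun h => hne (ContinuousLinearMap.coe_injective h))
  have hmap := (hc.hasStrictFDerivAt (by simp)).map_nhds_eq_of_surj hsurj
  have hO' : (extChartAt I x).symm ⁻¹' O ∈ 𝓝 y :=
    continuousAt_extChartAt_symm_of_mem hy (by rwa [hyx])
  have := image_mem_map (m := W ∘ (extChartAt I x).symm) hO'
  rw [hmap, Function.comp_apply, hyx] at this
  refine mem_of_superset this ?_
  rintro _ ⟨z, hz, rfl⟩
  exact ⟨_, hz, rfl⟩

/-- In the chart the difference has zero derivative on a ball, which is convex, so it keeps its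
value at the centre. -/
theorem eventually_eq_add_const_of_mfderiv_eq {W W' : X → ℝ} {x : X}
    (hW : ∀ᶠ z in 𝓝 x, MDifferentiableAt I 𝓘(ℝ, ℝ) W z)
    (hW' : ∀ᶠ z in 𝓝 x, MDifferentiableAt I 𝓘(ℝ, ℝ) W' z)
    (h : ∀ᶠ z in 𝓝 x, (mfderiv I 𝓘(ℝ, ℝ) W z : E →L[ℝ] ℝ) = mfderiv I 𝓘(ℝ, ℝ) W' z) :
    ∀ᶠ z in 𝓝 x, W z = W' z + (W x - W' x) := by
  have : IsManifold I 1 X := .of_le (n := ∞) (by simp)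
  set y := extChartAt I x x with hydef
  have hy : y ∈ (extChartAt I x).target := mem_extChartAt_target x
  have hyx : (extChartAt I x).symm y = x := extChartAt_to_inv x
  have hev := eventually_symm_of_eventually hy
    (p := fun z => MDifferentiableAt I 𝓘(ℝ, ℝ) W z ∧ MDifferentiableAt I 𝓘(ℝ, ℝ) W' z ∧
      (mfderiv I 𝓘(ℝ, ℝ) W z : E →L[ℝ] ℝ) = mfderiv I 𝓘(ℝ, ℝ) W' z) (by
      rw [hyx]; exact hW.and (hW'.and h))
  obtain ⟨r, hr, hball⟩ := Metric.mem_nhds_iff.mp hev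
  refine eventually_of_extChartAt (I := I) x (p := fun z => W z = W' z + (W x - W' x)) ?_
  have hdiff : ∀ V : X → ℝ, ∀ z ∈ (extChartAt I x).target,
      MDifferentiableAt I 𝓘(ℝ, ℝ) V ((extChartAt I x).symm z) →
      DifferentiableAt ℝ (V ∘ (extChartAt I x).symm) z := by
    intro V z hz hV
    have h := mdifferentiableWithinAt_extChartAt_symm hz
    rw [I.range_eq_univ, mdifferentiableWithinAt_univ] at h
    exact (hV.comp z h).differentiableAt
  filter_upwards [Metric.ball_mem_nhds y hr] with z hz
  have hconst := (convex_ball y r).is_const_of_fderivWithin_eq_zero (𝕜 := ℝ)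
    (f := fun z => (W ∘ (extChartAt I x).symm) z - (W' ∘ (extChartAt I x).symm) z)
    (fun z hz => by
      obtain ⟨⟨h1, h2, -⟩, ht⟩ := hball hz
      exact ((hdiff W z ht h1).sub (hdiff W' z ht h2)).differentiableWithinAt)
    (fun z hz => by
      obtain ⟨⟨h1, h2, h3⟩, ht⟩ := hball hz
      rw [fderivWithin_of_isOpen Metric.isOpen_ball hz,
        fderiv_fun_sub (hdiff W z ht h1) (hdiff W' z ht h2), ← chartForm_mfderiv ht h1,
        ← chartForm_mfderiv ht h2]
      exact sub_eq_zero.mpr (congrArg (fun A : E →L[ℝ] ℝ => A.comp _) h3))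
    hz (Metric.mem_ball_self hr)
  simp only [Function.comp_apply, hyx] at hconst
  linarith

end Generic

section Cylinder

variable {n : ℕ} {M : Type*} [TopologicalSpace M]
  [ChartedSpace (EuclideanSpace ℝ (Fin n)) M]

theorem exists_eq_horiz_add_vert (q : M × PosReal) (ξ : TangentSpace (cylModel n) q) :
    ∃ (u : TangentSpace (𝓡 n) q.1) (t : ℝ), ξ = horiz q u + t • vert q := by
  have : ∀ ξ : EuclideanSpace ℝ (Fin n) × ℝ, ξ = (ξ.1, 0) + ξ.2 • (0, 1) := by
    intro ξ; ext <;> simp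
  exact ⟨(show EuclideanSpace ℝ (Fin n) × ℝ from ξ).1,
    (show EuclideanSpace ℝ (Fin n) × ℝ from ξ).2, this ξ⟩

end Cylinder

/-! ### Pairs giving the same force field, and gauge transformations -/

section Riemannian

variable {n : ℕ} {M : Type*} [TopologicalSpace M]
  [ChartedSpace (EuclideanSpace ℝ (Fin n)) M]
  [RiemannianBundle (fun x : M => TangentSpace (𝓡 n) x)] {F : ForceField n M}

theorem forceExpr_smul {c : ℝ} (hc : c ≠ 0) (p : M) (v : TangentSpace (𝓡 n) p) (hv : v ≠ 0)
    (α : TangentSpace (cylModel n) (speedPoint p v hv) →L[ℝ] ℝ) (u : TangentSpace (𝓡 n) p) :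
    forceExpr 1 p v hv (c⁻¹ • α) u = forceExpr c p v hv α u := by
  have h1 : ∀ ξ, (c⁻¹ • α) ξ = c⁻¹ * α ξ := fun ξ => rfl
  simp only [forceExpr, h1]
  -- If the vertical component is zero, every quotient is a division by zero and both sides vanish.
  by_cases h0 : α (vert (speedPoint p v hv)) = 0
  · simp [h0]
  · field_simp

/-- Two pairs giving the same force field satisfy `h'(W') dW = h(W) dW'`. -/
theorem IsRepresentedOn.smul_differential_eq (hn : 1 ≤ n) {O O' : Set (M × PosReal)}
    {h h' : ℝ → ℝ} {W W' : M × PosReal → ℝ} (H : IsRepresentedOn F O h W)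
    (H' : IsRepresentedOn F O' h' W') {q : M × PosReal} (hq : q ∈ O) (hq' : q ∈ O') :
    h' (W' q) • differential (n := n) W q = h (W q) • differential (n := n) W' q := by
  obtain ⟨e1, e2⟩ := H.agree hn H' hq hq'
  have d := H.deriv_ne q hq
  have d' := H'.deriv_ne q hq'
  rw [div_eq_div_iff d d'] at e1
  refine ContinuousLinearMap.ext fun ξ => ?_
  obtain ⟨u, t, rfl⟩ := exists_eq_horiz_add_vert q ξ
  have eu := e2 u
  rw [div_eq_div_iff d d'] at eu
  change h' (W' q) * differential W q (horiz q u + t • vert q) =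
    h (W q) * differential W' q (horiz q u + t • vert q)
  rw [map_add, map_add, map_smul, map_smul, smul_eq_mul, smul_eq_mul]
  -- After multiplication by `W_v W'_v ≠ 0` the identity is a polynomial combination of the two
  -- cross-multiplied ratio equalities.
  refine mul_right_cancel₀ (mul_ne_zero d d') ?_
  linear_combination h' (W' q) * differential (n := n) W q (vert q) * eu -
    (differential (n := n) W' q (horiz q u) * differential (n := n) W q (vert q) +
      t * differential (n := n) W q (vert q) * differential (n := n) W' q (vert q)) * e1

theorem IsRepresentedOn.contMDiffAt {O : Set (M × PosReal)} {h : ℝ → ℝ} {W : M × PosReal → ℝ}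
    (H : IsRepresentedOn F O h W) {q : M × PosReal} (hq : q ∈ O) :
    ContMDiffAt (cylModel n) 𝓘(ℝ, ℝ) ∞ W q :=
  H.smooth_W.contMDiffAt (H.isOpen.mem_nhds hq)

theorem IsRepresentedOn.differential_ne_zero {O : Set (M × PosReal)} {h : ℝ → ℝ}
    {W : M × PosReal → ℝ} (H : IsRepresentedOn F O h W) {q : M × PosReal} (hq : q ∈ O) :
    differential (n := n) W q ≠ 0 := fun h0 => H.deriv_ne q hq (by rw [h0]; rfl)

/-- Near each point a closed `1`-form determining `F` is the differential of a function `W` that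
gives `F` together with the constant `1`. -/
theorem OneForm.Determines.exists_isRepresentedOn [IsManifold (𝓡 n) ∞ M] {θ : OneForm n M}
    (hs : θ.IsSmooth) (hc : θ.IsClosed) (hd : θ.Determines F) (q : M × PosReal) :
    ∃ (O : Set (M × PosReal)) (W : M × PosReal → ℝ),
      q ∈ O ∧ IsRepresentedOn F O (fun _ => 1) W := by
  have hs' := (contMDiff_form_iff (cylModel n) θ).1 hs q
  obtain ⟨B, G, hB, hqB, hBs, hG, hGd⟩ := exists_primitive_near
    (extChartAt_target_mem_nhds (I := cylModel n) q) hs' (hc q)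
  have hdW : ∀ x ∈ (extChartAt (cylModel n) q).source ∩ extChartAt (cylModel n) q ⁻¹' B,
      differential (n := n) (G ∘ extChartAt (cylModel n) q) x = θ x := fun x hx =>
    mfderiv_comp_extChartAt hx.1 (hGd _ hx.2)
  refine ⟨(extChartAt (cylModel n) q).source ∩ extChartAt (cylModel n) q ⁻¹' B,
    G ∘ extChartAt (cylModel n) q, ⟨mem_extChartAt_source q, hqB⟩, ?_, ?_, contDiffOn_const, ?_, ?_⟩
  · exact (continuousOn_extChartAt q).isOpen_inter_preimage (isOpen_extChartAt_source q) hB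
  · refine (contMDiffOn_iff_contDiffOn.2 hG).comp (t := B) ?_ fun x hx => hx.2
    refine (contMDiffOn_extChartAt (x := q)).mono fun x hx => ?_
    rw [← extChartAt_source (I := cylModel n)]
    exact hx.1
  · intro x hx
    rw [hdW x hx]
    exact hd.vert_ne x
  · intro p v hv hx u
    rw [hdW _ hx]
    exact hd.formula p v hv u

/-- Every pair is turned into a pair with `h ≡ 1` by a gauge transformation. -/
theorem IsRepresentedOn.gaugeRelatedAt [IsManifold (𝓡 n) ∞ M] (hn : 1 ≤ n)
    {O O' : Set (M × PosReal)} {h' : ℝ → ℝ} {W W' : M × PosReal → ℝ}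
    (H : IsRepresentedOn F O (fun _ => 1) W) (H' : IsRepresentedOn F O' h' W')
    {q : M × PosReal} (hq : q ∈ O) (hq' : q ∈ O') :
    GaugeRelatedAt q h' W' (fun _ => 1) W := by
  -- A zero of `h'(W')` would turn `h'(W') dW = dW'` into `dW' = 0`.
  have hne : h' (W' q) ≠ 0 := by
    intro h0
    have e := H.smul_differential_eq hn H' hq hq'
    rw [h0, zero_smul, one_smul] at e
    exact H'.differential_ne_zero hq' e.symm
  have himg : W' '' O' ∈ 𝓝 (W' q) := image_mem_nhds_of_mfderiv_ne_zero (I := cylModel n)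
    (H'.contMDiffAt hq') (H'.differential_ne_zero hq') (H'.isOpen.mem_nhds hq')
  obtain ⟨ρ, hρ, hρs, hmem, hval, hder⟩ :=
    exists_openPartialHomeomorph_deriv_eq_inv (W q) himg H'.smooth_h hne
  have hsrc : ∀ᶠ x in 𝓝 q, W' x ∈ ρ.source :=
    (H'.contMDiffAt hq').continuousAt.eventually (ρ.open_source.mem_nhds hmem)
  have hO : ∀ᶠ x in 𝓝 q, x ∈ O := H.isOpen.mem_nhds hq
  have hO' : ∀ᶠ x in 𝓝 q, x ∈ O' := H'.isOpen.mem_nhds hq'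
  have hmd : ∀ {x}, x ∈ O' → MDifferentiableAt (cylModel n) 𝓘(ℝ, ℝ) W' x := fun hx =>
    (H'.contMDiffAt hx).mdifferentiableAt (by simp)
  refine ⟨ρ, hρ, hρs, hmem, ?_, fun w hw => ?_⟩
  -- The chain rule gives `d(ρ ∘ W') = dW' / h'(W') = dW`; the remaining constant is zero because `ρ
  -- (W' q) = W q`.
  · have hconst := eventually_eq_add_const_of_mfderiv_eq (I := cylModel n) (W := W) (W' := ρ ∘ W')
      (x := q) (hO.mono fun x hx => (H.contMDiffAt hx).mdifferentiableAt (by simp))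
      (by
        filter_upwards [hO', hsrc] with x hx hx'
        exact MDifferentiableAt.comp x (hder _ hx').2.differentiableAt.mdifferentiableAt (hmd hx))
      (by
        filter_upwards [hO, hO', hsrc] with x hx hx' hxs
        have e := H.smul_differential_eq hn H' hx hx'
        rw [one_smul] at e
        obtain ⟨hne, hd⟩ := hder _ hxs
        rw [mfderiv_comp x hd.differentiableAt.mdifferentiableAt (hmd hx'), mfderiv_eq_fderiv]
        have e2 : (fderiv ℝ ρ (W' x)).comp (differential (n := n) W' x) =
            (h' (W' x))⁻¹ • differential (n := n) W' x := by
          refine ContinuousLinearMap.ext fun ξ => ?_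
          change fderiv ℝ ρ (W' x) (differential W' x ξ) = (h' (W' x))⁻¹ * differential W' x ξ
          rw [hd.hasFDerivAt.fderiv]
          simp [mul_comm]
        refine Eq.trans ?_ e2.symm
        rw [← e, inv_smul_smul₀ hne]
        rfl)
    filter_upwards [hconst] with x hx
    rw [hx, Function.comp_apply, Function.comp_apply, hval, sub_self, add_zero]
  · obtain ⟨hne, hd⟩ := hder _ (ρ.map_target hw)
    rw [hd.deriv, mul_inv_cancel₀ hne]

/-- The `W q` are local primitives of `θ`. On overlaps, pairs with `h = 1` have equal differentials,
hence locally constant differences. -/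
theorem isGloballyNormalized_of_determines [IsManifold (𝓡 n) ∞ M] (hn : 1 ≤ n) {θ : OneForm n M}
    (hs : θ.IsSmooth) (hc : θ.IsClosed) (hd : θ.Determines F) : IsGloballyNormalized F := by
  choose O W hO hW using hd.exists_isRepresentedOn hs hc
  refine ⟨O, W, fun q => ⟨hO q, hW q⟩, fun q q' x hx => ?_,
    fun O' h' W' H' q x hx => (hW q).gaugeRelatedAt hn H' hx.1 hx.2⟩
  have e : ∀ᶠ y in 𝓝 x, y ∈ O q := (hW q).isOpen.mem_nhds hx.1
  have e' : ∀ᶠ y in 𝓝 x, y ∈ O q' := (hW q').isOpen.mem_nhds hx.2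
  refine ⟨_, eventually_eq_add_const_of_mfderiv_eq (I := cylModel n)
    (e.mono fun y hy => ((hW q).contMDiffAt hy).mdifferentiableAt (by simp))
    (e'.mono fun y hy => ((hW q').contMDiffAt hy).mdifferentiableAt (by simp)) ?_⟩
  filter_upwards [e, e'] with y hy hy'
  have := (hW q).smul_differential_eq hn (hW q') hy hy'
  rw [one_smul, one_smul] at this
  exact this

/-! ### The global form `dW / h(W)` -/

/-- The `1`-form `dW / h(W)` of a normal shift force field. -/
def IsNormalShiftForce.form (hF : IsNormalShiftForce F) : OneForm n M := fun q =>
  (hF.h q (hF.W q q))⁻¹ • differential (n := n) (hF.W q) q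

theorem IsRepresentedOn.ne_zero_of_attachedSection_ne_zero (hn : 1 ≤ n)
    (hF : IsNormalShiftForce F) {q : M × PosReal} (h0 : attachedSection hF q ≠ 0)
    {O : Set (M × PosReal)} {h : ℝ → ℝ} {W : M × PosReal → ℝ} (H : IsRepresentedOn F O h W)
    (hq : q ∈ O) : h (W q) ≠ 0 := by
  intro e
  rw [attachedSection_eq hn hF H hq, e, zero_div, zero_smul, map_zero] at h0
  exact h0 rfl

theorem attachedSection_ne_zero (hn : 1 ≤ n) (hF : IsNormalShiftForce F)
    {O : Set (M × PosReal)} {h : ℝ → ℝ} {W : M × PosReal → ℝ} (H : IsRepresentedOn F O h W)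
    {q : M × PosReal} (hq : q ∈ O) (h0 : h (W q) ≠ 0) : attachedSection hF q ≠ 0 := by
  rw [attachedSection_eq hn hF H hq, Submodule.mkQ_apply, Ne, Submodule.Quotient.mk_eq_zero,
    attachedDistribution_eq hn hF H hq]
  intro hm
  have h1 : differential W q ((h (W q) / differential (n := n) W q (vert q)) • vert q) = 0 := hm
  rw [map_smul, smul_eq_mul, div_mul_cancel₀ _ (H.deriv_ne q hq)] at h1
  exact h0 h1

/-- The form is defined with a separately chosen pair at each point. Independence of the choice lets
a single pair describe it on a whole neighbourhood, on which smoothness and closedness rest. -/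
theorem IsNormalShiftForce.form_eq (hn : 1 ≤ n) (hF : IsNormalShiftForce F)
    (h0 : ∀ q, attachedSection hF q ≠ 0) {O : Set (M × PosReal)} {h : ℝ → ℝ}
    {W : M × PosReal → ℝ} (H : IsRepresentedOn F O h W) {q : M × PosReal} (hq : q ∈ O) :
    hF.form q = (h (W q))⁻¹ • differential (n := n) W q := by
  obtain ⟨O', hq', H'⟩ := hF.chosen q
  have a := H.ne_zero_of_attachedSection_ne_zero hn hF (h0 q) hq
  have a' := H'.ne_zero_of_attachedSection_ne_zero hn hF (h0 q) hq'
  rw [form, inv_smul_eq_iff₀ a', smul_comm, eq_inv_smul_iff₀ a]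
  exact H'.smul_differential_eq hn H hq' hq

theorem IsNormalShiftForce.form_determines (hn : 1 ≤ n) (hF : IsNormalShiftForce F)
    (h0 : ∀ q, attachedSection hF q ≠ 0) : hF.form.Determines F where
  vert_ne q := by
    obtain ⟨O, hq, H⟩ := hF.chosen q
    exact mul_ne_zero (inv_ne_zero (H.ne_zero_of_attachedSection_ne_zero hn hF (h0 q) hq))
      (H.deriv_ne q hq)
  formula p v hv u := by
    obtain ⟨O, hq, H⟩ := hF.chosen (speedPoint p v hv)
    rw [H.formula p v hv hq u]
    exact (forceExpr_smul (H.ne_zero_of_attachedSection_ne_zero hn hF (h0 _) hq) ..).symm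

/-- The coordinate expression of the form `dW / h(W)`. -/
theorem IsNormalShiftForce.chartForm_form [IsManifold (𝓡 n) ∞ M] (hn : 1 ≤ n)
    (hF : IsNormalShiftForce F) (h0 : ∀ q, attachedSection hF q ≠ 0) (q₀ : M × PosReal)
    {y : EuclideanSpace ℝ (Fin n) × ℝ} (hy : y ∈ (extChartAt (cylModel n) q₀).target) :
    ∃ w k : EuclideanSpace ℝ (Fin n) × ℝ → ℝ, ContDiffAt ℝ ∞ w y ∧ ContDiffAt ℝ ∞ k y ∧
      (∃ a : ℝ, HasFDerivAt k (a • fderiv ℝ w y) y) ∧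
      chartForm (cylModel n) hF.form q₀ =ᶠ[𝓝 y] fun z => k z • fderiv ℝ w z := by
  set ψ := (extChartAt (cylModel n) q₀).symm with hψ
  obtain ⟨O, h, W, hq, H⟩ := hF (ψ y)
  have hev := eventually_symm_of_eventually hy (H.isOpen.mem_nhds hq)
  obtain ⟨D, hD, hDo, hyD⟩ := eventually_nhds_iff.1 hev
  have hw : ∀ z ∈ D, ContDiffAt ℝ ∞ (W ∘ ψ) z := fun z hz =>
    contDiffAt_comp_extChartAt_symm (hD z hz).2 (H.contMDiffAt (hD z hz).1)
  have hne : ∀ z ∈ D, h (W (ψ z)) ≠ 0 := fun z hz =>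
    H.ne_zero_of_attachedSection_ne_zero hn hF (h0 _) (hD z hz).1
  have hmaps : MapsTo (W ∘ ψ) D (W '' O) := fun z hz => mem_image_of_mem W (hD z hz).1
  have hinv : ContDiffOn ℝ ∞ (fun z => (h ((W ∘ ψ) z))⁻¹) D :=
    (H.smooth_h.comp (fun z hz => (hw z hz).contDiffWithinAt) hmaps).inv hne
  refine ⟨W ∘ ψ, fun z => (h ((W ∘ ψ) z))⁻¹, hw y hyD, hinv.contDiffAt (hDo.mem_nhds hyD), ?_, ?_⟩
  -- The constant `a` is the derivative of `1/h` within the set of values of `W`. As `W ∘ ψ` maps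
  -- the open set `D` into that set, the composite has a full derivative at `y`.
  · have hh : DifferentiableWithinAt ℝ h (W '' O) ((W ∘ ψ) y) :=
      (H.smooth_h.differentiableOn (by simp)) _ (hmaps hyD)
    have h1 := hh.hasDerivWithinAt.inv (hne y hyD)
    have h2 := h1.comp_hasFDerivWithinAt y
      ((hw y hyD).differentiableAt (by simp)).hasFDerivAt.hasFDerivWithinAt hmaps
    exact ⟨_, h2.hasFDerivAt (hDo.mem_nhds hyD)⟩
  · filter_upwards [hDo.mem_nhds hyD] with z hz
    have hm := (H.contMDiffAt (hD z hz).1).mdifferentiableAt (by simp)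
    rw [← chartForm_mfderiv (hD z hz).2 hm, chartForm, hF.form_eq hn h0 H (hD z hz).1]
    rfl

theorem IsNormalShiftForce.form_isSmooth [IsManifold (𝓡 n) ∞ M] (hn : 1 ≤ n)
    (hF : IsNormalShiftForce F) (h0 : ∀ q, attachedSection hF q ≠ 0) : hF.form.IsSmooth := by
  refine (contMDiff_form_iff (cylModel n) hF.form).2 fun q₀ y hy => ?_
  obtain ⟨w, k, hw, hk, -, he⟩ := hF.chartForm_form hn h0 q₀ hy
  exact ((hk.smul (hw.fderiv_right (m := ∞) (by simp))).congr_of_eventuallyEq he).contDiffWithinAt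

theorem IsNormalShiftForce.form_isClosed [IsManifold (𝓡 n) ∞ M] (hn : 1 ≤ n)
    (hF : IsNormalShiftForce F) (h0 : ∀ q, attachedSection hF q ≠ 0) : hF.form.IsClosed := by
  intro q₀ y hy ξ η
  obtain ⟨w, k, hw, -, ⟨a, hk⟩, he⟩ := hF.chartForm_form hn h0 q₀ hy
  change fderiv ℝ (chartForm (cylModel n) hF.form q₀) y ξ η =
    fderiv ℝ (chartForm (cylModel n) hF.form q₀) y η ξ
  rw [he.fderiv_eq]
  exact fderiv_smul_fderiv_symm hw a hk ξ η

end Riemannian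

end NormalShift

end
open NormalShift in
theorem theorem7p1 {n : ℕ} (hn : 1 ≤ n) {M : Type*} [TopologicalSpace M]
    [ChartedSpace (EuclideanSpace ℝ (Fin n)) M] [IsManifold (𝓡 n) ∞ M]
    [RiemannianBundle (fun x : M => TangentSpace (𝓡 n) x)]
    [IsContMDiffRiemannianBundle (𝓡 n) ∞ (EuclideanSpace ℝ (Fin n))
      (fun x : M => TangentSpace (𝓡 n) x)]
    (F : ForceField n M) (hF : IsNormalShiftForce F) :
    ((∀ q, attachedSection hF q ≠ 0) →
      ∃ θ : OneForm n M, θ.IsSmooth ∧ θ.IsClosed ∧ θ.Determines F) ∧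
    ((∃ θ : OneForm n M, θ.IsSmooth ∧ θ.IsClosed ∧ θ.Determines F) ↔
      IsGloballyNormalized F) := by
  have key : (∀ q, attachedSection hF q ≠ 0) →
      ∃ θ : OneForm n M, θ.IsSmooth ∧ θ.IsClosed ∧ θ.Determines F := fun h0 =>
    ⟨hF.form, hF.form_isSmooth hn h0, hF.form_isClosed hn h0, hF.form_determines hn h0⟩
  refine ⟨key, ?_, ?_⟩
  · rintro ⟨θ, hs, hc, hd⟩
    exact isGloballyNormalized_of_determines hn hs hc hd
  · rintro ⟨O, W, hW, -, -⟩
    -- The normalized pairs alone give `s ≠ 0`; the overlap and gauge conditions are not needed to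
    -- recover the form.
    exact key fun q => attachedSection_ne_zero hn hF (hW q).2 (hW q).1 one_ne_zero
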